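/- Let $m\ge 1$ and consider the scalar delay differential equation $$\dot x(t)+f(t,x(t))+\sum_{k=1}^m g_k(t,x(h_k(t)))=0,\quad t\ge 0,\qquad x(t)=\varphi(t),\ t\le 0, \tag{1}$$ where a solution is a function that is absolutely continuous on each interval $[0,T]$, satisfies the equation for almost every $t\ge0$ and satisfies the initial condition for $t\le 0$. Assume: (i) each $h_k$ is Lebesgue measurable on $[0,\infty)$, $h_k(t)\le t$, and $\lim_{t\to\infty}h_k(t)=\infty$; (ii) $f,g_k:[0,\infty)\times\mathbb R\to\mathbb R$ are continuous, $f(t,0)=g_k(t,0)=0$, and $f(t,u)u>0$, $g_k(t,u)u>0$ for all $t\ge 0$, $u\ne0$ and $k=1,\dots,m$; (iii) there are $-\infty\le x_1^0\le 0\le x_2^0\le\infty$ and $-\infty<x_1\le 0\le x_2<\infty$ such that for every bounded Borel measurable $\varphi:(-\infty,0]\to\mathbb R$ with $x_1^0\le\varphi\le x_2^0$ problem (1) has a unique solution $x$, and this solution satisfies $x_1\le x(t)\le x_2$ for all sufficiently large $t$ (in particular, it is enough that this holds for all $t\ge 0$). Suppose that there are positive numbers $a_0$, $A$, $b_1,\dots,b_m$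 such that for all $t\ge0$, all $u\neq0$ with $x_1\le u\le x_2$, and all $k$, $$a_0\le\frac{f(t,u)}{u}\le A,\qquad 0\le\frac{g_k(t,u)}{u}\le b_k,$$ that $t-h_k(t)\le h_0$ for all $t\ge 0$ and all $k$, and that, with $b_0=\sum_{k=1}^m b_k$, $$\frac{a_0}{b_0}e^{-Ah_0}>\ln\frac{b_0^2+a_0b_0}{b_0^2+a_0^2}.$$ Then for every bounded Borel measurable $\varphi:(-\infty,0]\to\mathbb R$ with $x_1^0\le\varphi\le x_2^0$ the solution $x$ of (1) satisfies $\lim_{t\to\infty}x(t)=0$. -/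

import Mathlib

open Set Filter Topology MeasureTheory

/-- Delay functions on `[0, ∞)`: Lebesgue measurable, `h t ≤ t`, and `h t → ∞` as `t → ∞`.
(A real function is Lebesgue measurable on `[0, ∞)` exactly when it is a.e. equal there to a Borel
function.) -/
structure IsDelayFunction (h : ℝ → ℝ) : Prop where
  aemeasurable : AEMeasurable h (volume.restrict (Ici 0))
  le_self : ∀ t, 0 ≤ t → h t ≤ t
  tendsto : Tendsto h atTop atTop

/-- Admissible initial functions: bounded Borel measurable functions on `(-∞, 0]` with values
between the (possibly infinite) bounds `lo` and `hi`. -/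
structure IsAdmissibleInitial (lo hi : EReal) (φ : Iic (0 : ℝ) → ℝ) : Prop where
  measurable : Measurable φ
  bounded : ∃ C : ℝ, ∀ t, |φ t| ≤ C
  lower : ∀ t, lo ≤ (φ t : EReal)
  upper : ∀ t, (φ t : EReal) ≤ hi

/-- `x` is a (global) solution of
`x'(t) + f (t, x t) + ∑ k, g k (t, x (h k t)) = 0` for `t ≥ 0`, with `x t = φ t` for `t ≤ 0`:
it is absolutely continuous on every `[0, T]`, satisfies the equation for almost every `t ≥ 0`,
and satisfies the initial condition. -/
structure IsDelaySolution {m : ℕ} (f : ℝ → ℝ → ℝ) (g : Fin m → ℝ → ℝ → ℝ) (h : Fin m → ℝ → ℝ)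
    (φ : Iic (0 : ℝ) → ℝ) (x : ℝ → ℝ) : Prop where
  absCont : ∀ T, 0 ≤ T → AbsolutelyContinuousOnInterval x 0 T
  initial : ∀ t : Iic (0 : ℝ), x t = φ t
  equation : ∀ᵐ t ∂(volume.restrict (Ici (0 : ℝ))),
    DifferentiableAt ℝ x t ∧ deriv x t + f t (x t) + ∑ k, g k t (x (h k t)) = 0

/-! With a = f(t,x)/x and D = -∑ g_k, the equation reads x' = -a x + D. In the time α = ∫ a the
decay rate is 1, delays are at most A h₀, and D/a is at most B = b₀/a₀ times a bound on the negative
part of the delayed values.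

Suppose |x| ≤ K and x is positive after a zero ξ. Integrating the equation up to ξ bounds -x at
α-distance σ before ξ by BK(e^σ - 1) (`neg_le_before_zero`), besides K. Feeding these two bounds
back gives x ≤ θK after ξ (`le_of_zero`), and the logarithmic condition allows θ < 1
(`exists_isContractionBound`). If x stays positive it decays exponentially. Iterating for x and -x
gives |x| ≤ θⁿK eventually (`tendsto_zero`). -/

theorem AbsolutelyContinuousOnInterval.le_of_ae_hasDerivAt_nonpos {f : ℝ → ℝ} {u v : ℝ}
    (huv : u ≤ v) (hf : AbsolutelyContinuousOnInterval f u v)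
    (hd : ∀ᵐ s, s ∈ Icc u v → ∃ d ≤ 0, HasDerivAt f d s) : f v ≤ f u := by
  have hint := hf.integral_deriv_eq_sub
  have : ∫ s in u..v, deriv f s ≤ 0 := by
    rw [intervalIntegral.integral_of_le huv]
    apply integral_nonpos_of_ae
    rw [EventuallyLE, ae_restrict_iff' measurableSet_Ioc]
    filter_upwards [hd] with s hs hmem
    obtain ⟨d, hd0, hd⟩ := hs ⟨hmem.1.le, hmem.2⟩
    simpa [hd.deriv] using hd0
  linarith

theorem AbsolutelyContinuousOnInterval.exp_comp_of_lipschitzWith {α : ℝ → ℝ} {C : NNReal}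
    (hα : LipschitzWith C α) (u v : ℝ) :
    AbsolutelyContinuousOnInterval (fun s => Real.exp (α s)) u v := by
  obtain ⟨M, hM⟩ := (isCompact_uIcc (a := u) (b := v)).bddAbove_image
    (f := α) hα.continuous.continuousOn
  have hexp : LipschitzOnWith (Real.exp M).toNNReal Real.exp (Iic M) := by
    apply Convex.lipschitzOnWith_of_nnnorm_deriv_le (𝕜 := ℝ)
    · intro s _
      exact Real.differentiableAt_exp
    · intro s hs
      rw [Real.deriv_exp, ← NNReal.coe_le_coe, coe_nnnorm, Real.norm_eq_abs, Real.abs_exp,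
        Real.coe_toNNReal _ (Real.exp_pos M).le]
      exact Real.exp_le_exp.2 hs
    · exact convex_Iic M
  exact (hexp.comp (hα.lipschitzOnWith (s := uIcc u v))
    (fun s hs => hM (mem_image_of_mem α hs))).absolutelyContinuousOnInterval

/-- `x' = -a x + D` on `[T, ∞)`, where `α` is a primitive of `a` and the feedback `D` at time `s`
is controlled, up to the factor `B`, by the values of `x` at the delayed times `h k s`. -/
structure IsDelayedFeedback {ι : Type*} (a₀ A B h₀ T : ℝ) (h : ι → ℝ → ℝ) (a α D x : ℝ → ℝ) :
    Prop where
  absCont : ∀ u v, T ≤ u → u ≤ v → AbsolutelyContinuousOnInterval x u v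
  lipschitz : LipschitzWith A.toNNReal α
  primitive_lower : ∀ u v, u ≤ v → a₀ * (v - u) ≤ α v - α u
  primitive_upper : ∀ u v, u ≤ v → α v - α u ≤ A * (v - u)
  hasDerivAt : ∀ᵐ s, T ≤ s → HasDerivAt α (a s) s ∧ HasDerivAt x (-(a s * x s) + D s) s
  delay_le : ∀ k s, T ≤ s → h k s ≤ s
  le_delay : ∀ k s, T ≤ s → s - h₀ ≤ h k s
  feedback_upper : ∀ s, T ≤ s → ∀ c, 0 ≤ c → (∀ k, -x (h k s) ≤ c) → D s ≤ B * c * a s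
  feedback_lower : ∀ s, T ≤ s → ∀ c, 0 ≤ c → (∀ k, x (h k s) ≤ c) → -D s ≤ B * c * a s

/-! ### Estimates for the delayed feedback equation -/

namespace IsDelayedFeedback

variable {ι : Type*} {a₀ A B h₀ T : ℝ} {h : ι → ℝ → ℝ} {a α D x : ℝ → ℝ}

theorem neg (p : IsDelayedFeedback a₀ A B h₀ T h a α D x) :
    IsDelayedFeedback a₀ A B h₀ T h a α (fun s => -D s) (fun s => -x s) where
  absCont u v hu huv := (p.absCont u v hu huv).neg
  lipschitz := p.lipschitz
  primitive_lower := p.primitive_lower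
  primitive_upper := p.primitive_upper
  hasDerivAt := by
    filter_upwards [p.hasDerivAt] with s hs hT
    exact ⟨(hs hT).1, (hs hT).2.fun_neg.congr_deriv (by ring)⟩
  delay_le := p.delay_le
  le_delay := p.le_delay
  feedback_upper s hs c hc hx := p.feedback_lower s hs c hc (by simpa using hx)
  feedback_lower s hs c hc hx := by
    simpa using p.feedback_upper s hs c hc hx

theorem mono (p : IsDelayedFeedback a₀ A B h₀ T h a α D x) {T' : ℝ} (hT : T ≤ T') :
    IsDelayedFeedback a₀ A B h₀ T' h a α D x where
  absCont u v hu huv := p.absCont u v (hT.trans hu) huv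
  lipschitz := p.lipschitz
  primitive_lower := p.primitive_lower
  primitive_upper := p.primitive_upper
  hasDerivAt := by
    filter_upwards [p.hasDerivAt] with s hs hT' using hs (hT.trans hT')
  delay_le k s hs := p.delay_le k s (hT.trans hs)
  le_delay k s hs := p.le_delay k s (hT.trans hs)
  feedback_upper s hs := p.feedback_upper s (hT.trans hs)
  feedback_lower s hs := p.feedback_lower s (hT.trans hs)

/-- Variation of constants: (e^α x)' = e^α D ≤ a (P - c e^α), and the right side is the derivative
of P α - c e^α. -/
theorem exp_mul_sub_le (p : IsDelayedFeedback a₀ A B h₀ T h a α D x) {u v P c : ℝ}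
    (hu : T ≤ u) (huv : u ≤ v)
    (hD : ∀ s ∈ Icc u v, D s ≤ a s * (P * Real.exp (-α s) - c)) :
    Real.exp (α v) * x v - Real.exp (α u) * x u ≤
      P * (α v - α u) - c * (Real.exp (α v) - Real.exp (α u)) := by
  have hE := AbsolutelyContinuousOnInterval.exp_comp_of_lipschitzWith p.lipschitz u v
  have hα : AbsolutelyContinuousOnInterval α u v :=
    (p.lipschitz.lipschitzOnWith (s := uIcc u v)).absolutelyContinuousOnInterval
  have hy : AbsolutelyContinuousOnInterval
      (fun s => Real.exp (α s) * x s - P * α s + c * Real.exp (α s)) u v :=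
    ((hE.mul (p.absCont u v hu huv)).sub (hα.const_mul P)).add (hE.const_mul c)
  have := hy.le_of_ae_hasDerivAt_nonpos huv (by
    filter_upwards [p.hasDerivAt] with s hs hmem
    obtain ⟨h1, h2⟩ := hs (hu.trans hmem.1)
    refine ⟨_, ?_, ((h1.exp.mul h2).sub (h1.const_mul P)).add (h1.exp.const_mul c)⟩
    have hE1 : Real.exp (α s) * Real.exp (-α s) = 1 := by
      rw [← Real.exp_add]; simp
    have := mul_le_mul_of_nonneg_left (hD s hmem) (Real.exp_pos (α s)).le
    linear_combination this + P * a s * hE1)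
  linarith

/-- Feedback of size at most BK must lift x back to zero by ξ, so x cannot be very negative shortly
before ξ. -/
theorem neg_le_before_zero (p : IsDelayedFeedback a₀ A B h₀ T h a α D x) {K ξ s : ℝ}
    (hK : 0 ≤ K) (hbd : ∀ t, T - h₀ ≤ t → |x t| ≤ K) (hs : T ≤ s) (hsξ : s ≤ ξ) (hξ : x ξ = 0) :
    -x s ≤ B * K * (Real.exp (α ξ - α s) - 1) := by
  have h1 := p.exp_mul_sub_le (P := 0) (c := -(B * K)) hs hsξ (fun r hr => by
    have := p.feedback_upper r (hs.trans hr.1) K hK (fun k => by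
      have := hbd (h k r) (by linarith [p.le_delay k r (hs.trans hr.1), hr.1])
      linarith [neg_le_abs (x (h k r))])
    linarith)
  rw [Real.exp_sub, hξ] at *
  have hpos := Real.exp_pos (α s)
  rw [← mul_le_mul_iff_right₀ hpos]
  have : Real.exp (α s) * (B * K * (Real.exp (α ξ) / Real.exp (α s) - 1)) =
      B * K * (Real.exp (α ξ) - Real.exp (α s)) := by field_simp
  rw [this]
  linarith

/-- The two pieces of the normalised extremal solution stay below `θ`. -/
structure IsContractionBound (B H s₀ θ : ℝ) : Prop where
  pos : 0 < θ
  switch_nonneg : 0 ≤ s₀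
  switch_le : s₀ ≤ H
  early : ∀ τ ≤ s₀, B * (1 - Real.exp (-τ)) ≤ θ
  late : ∀ τ, s₀ ≤ τ → τ ≤ H →
    Real.exp (-τ) * (B * (Real.exp s₀ - 1) + B ^ 2 * Real.exp H * (τ - s₀)
      - B ^ 2 * (Real.exp τ - Real.exp s₀)) ≤ θ

/-- Put τ = α - α ξ. Up to s₀ the feedback is bounded through K. Later, a delayed argument before ξ
lies within α-distance H - τ of ξ, so `neg_le_before_zero` bounds D/a by B²K(e^(H-τ) - 1); delayed
values after ξ are positive and only push x down. -/
theorem le_of_zero_of_primitive_le (p : IsDelayedFeedback a₀ A B h₀ T h a α D x)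
    {K H s₀ θ ξ t : ℝ} (hB : 0 ≤ B) (hA : 0 ≤ A) (ha₀ : 0 < a₀)
    (hc : IsContractionBound B H s₀ θ) (hH : A * h₀ ≤ H)
    (hK : 0 ≤ K) (hbd : ∀ t, T - h₀ ≤ t → |x t| ≤ K) (hTξ : T ≤ ξ) (hTξ' : T + h₀ ≤ ξ)
    (hξt : ξ ≤ t) (hξ : x ξ = 0) (hpos : ∀ s, ξ < s → s ≤ t → 0 < x s)
    (hαt : α t ≤ α ξ + H) : x t ≤ θ * K := by
  have early : ∀ v, ξ ≤ v → Real.exp (α v) * x v ≤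
      B * K * (Real.exp (α v) - Real.exp (α ξ)) := by
    intro v hv
    have h1 := p.exp_mul_sub_le (P := 0) (c := -(B * K)) hTξ hv (fun r hr => by
      have := p.feedback_upper r (hTξ.trans hr.1) K hK (fun k => by
        have := hbd (h k r) (by linarith [p.le_delay k r (hTξ.trans hr.1), hr.1])
        linarith [neg_le_abs (x (h k r))])
      linarith)
    rw [hξ] at h1
    linarith
  have hmonoα : ∀ u v, u ≤ v → α u ≤ α v := fun u v huv => by
    nlinarith [p.primitive_lower u v huv, mul_nonneg ha₀.le (sub_nonneg.2 huv)]
  obtain ⟨τ, hτ⟩ : ∃ τ, α t = α ξ + τ := ⟨α t - α ξ, by ring⟩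
  have hEt := Real.exp_pos (α t)
  have hEξ := Real.exp_pos (α ξ)
  have hexp : Real.exp (α t) = Real.exp (α ξ) * Real.exp τ := by rw [hτ, Real.exp_add]
  have hτ1 : Real.exp τ * Real.exp (-τ) = 1 := by rw [← Real.exp_add]; simp
  rcases le_total τ s₀ with hle | hge
  · have h1 := early t hξt
    have h2 := mul_le_mul_of_nonneg_right (hc.early τ hle) hK
    refine le_trans ?_ h2
    rw [← mul_le_mul_iff_right₀ hEt]
    rw [hexp] at h1 ⊢
    linear_combination h1 + Real.exp (α ξ) * B * K * hτ1
  · obtain ⟨σ, hσ, hασ⟩ : α ξ + s₀ ∈ α '' Icc ξ t :=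
      intermediate_value_Icc hξt p.lipschitz.continuous.continuousOn
        ⟨by linarith [hc.switch_nonneg], by linarith⟩
    have h1 := early σ hσ.1
    have h2 := p.exp_mul_sub_le (P := B ^ 2 * K * Real.exp (α ξ + H)) (c := B ^ 2 * K)
      (hTξ.trans hσ.1) hσ.2 (fun r hr => by
        have hξr := hσ.1.trans hr.1
        have hTr := hTξ.trans hξr
        have hαr := hmonoα r t hr.2
        have := p.feedback_upper r hTr (B * K * (Real.exp (α ξ + H - α r) - 1))
          (mul_nonneg (mul_nonneg hB hK)
            (sub_nonneg.2 (Real.one_le_exp (by linarith)))) (fun k => by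
            rcases le_or_gt (h k r) ξ with hk | hk
            · have h3 := p.neg_le_before_zero hK hbd
                (by linarith [p.le_delay k r hTr]) hk hξ
              refine h3.trans (mul_le_mul_of_nonneg_left ?_ (mul_nonneg hB hK))
              have h4 := p.primitive_upper (h k r) r (p.delay_le k r hTr)
              have h5 : A * (r - h k r) ≤ A * h₀ :=
                mul_le_mul_of_nonneg_left (by linarith [p.le_delay k r hTr]) hA
              have := Real.exp_le_exp.2 (show α ξ - α (h k r) ≤ α ξ + H - α r by linarith)
              linarith
            · have h3 := hpos _ hk ((p.delay_le k r hTr).trans hr.2)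
              have : 0 ≤ B * K * (Real.exp (α ξ + H - α r) - 1) :=
                mul_nonneg (mul_nonneg hB hK) (sub_nonneg.2 (Real.one_le_exp (by linarith)))
              linarith)
        rw [sub_eq_add_neg (α ξ + H), Real.exp_add (α ξ + H)] at this
        linarith)
    have h3 := mul_le_mul_of_nonneg_right (hc.late τ hge (by linarith)) hK
    refine le_trans ?_ h3
    rw [← mul_le_mul_iff_right₀ hEt]
    rw [hασ, hτ, Real.exp_add, Real.exp_add, Real.exp_add] at h2
    rw [hασ, Real.exp_add] at h1
    rw [hexp]
    linear_combination h1 + h2 - Real.exp (α ξ) * K * (B * (Real.exp s₀ - 1)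
      + B ^ 2 * Real.exp H * (τ - s₀) - B ^ 2 * (Real.exp τ - Real.exp s₀)) * hτ1

/-- Once α exceeds α ξ + H, no delayed argument precedes ξ, so the feedback is nonpositive and e^α x
cannot grow. -/
theorem le_of_zero (p : IsDelayedFeedback a₀ A B h₀ T h a α D x)
    {K H s₀ θ ξ t : ℝ} (hB : 0 ≤ B) (hA : 0 ≤ A) (ha₀ : 0 < a₀)
    (hc : IsContractionBound B H s₀ θ) (hH : A * h₀ ≤ H)
    (hK : 0 ≤ K) (hbd : ∀ t, T - h₀ ≤ t → |x t| ≤ K) (hTξ : T ≤ ξ) (hTξ' : T + h₀ ≤ ξ)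
    (hξt : ξ ≤ t) (hξ : x ξ = 0) (hpos : ∀ s, ξ < s → s ≤ t → 0 < x s) : x t ≤ θ * K := by
  rcases le_total (α t) (α ξ + H) with hle | hge
  · exact p.le_of_zero_of_primitive_le hB hA ha₀ hc hH hK hbd hTξ hTξ' hξt hξ hpos hle
  obtain ⟨σ, hσ, hασ⟩ : α ξ + H ∈ α '' Icc ξ t :=
    intermediate_value_Icc hξt p.lipschitz.continuous.continuousOn
      ⟨by linarith [hc.switch_nonneg, hc.switch_le], hge⟩
  have hmonoα : ∀ u v, u ≤ v → α u ≤ α v := fun u v huv => by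
    nlinarith [p.primitive_lower u v huv, mul_nonneg ha₀.le (sub_nonneg.2 huv)]
  have h1 := p.le_of_zero_of_primitive_le hB hA ha₀ hc hH hK hbd hTξ hTξ' hσ.1 hξ
    (fun s hs hs' => hpos s hs (hs'.trans hσ.2)) hασ.le
  have h2 := p.exp_mul_sub_le (P := 0) (c := 0) (hTξ.trans hσ.1) hσ.2 (fun r hr => by
    have hTr := hTξ.trans (hσ.1.trans hr.1)
    have := p.feedback_upper r hTr 0 le_rfl (fun k => by
      rcases lt_or_ge (h k r) ξ with hk | hk
      · have h4 := p.primitive_upper (h k r) r (p.delay_le k r hTr)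
        have h5 : A * (r - h k r) ≤ A * h₀ :=
          mul_le_mul_of_nonneg_left (by linarith [p.le_delay k r hTr]) hA
        have h6 := p.primitive_lower (h k r) ξ hk.le
        have h7 := mul_pos ha₀ (sub_pos.2 hk)
        linarith [hmonoα σ r hr.1]
      · rcases hk.eq_or_lt with hk | hk
        · rw [← hk, hξ]; simp
        · linarith [hpos _ hk ((p.delay_le k r hTr).trans hr.2)])
    linarith)
  have hmono := Real.exp_le_exp.2 (hmonoα σ t hσ.2)
  have hxσ : 0 ≤ θ * K := mul_nonneg hc.pos.le hK
  have hE := Real.exp_pos (α t)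
  rw [← mul_le_mul_iff_right₀ hE]
  have h3 : Real.exp (α σ) * x σ ≤ Real.exp (α σ) * (θ * K) :=
    mul_le_mul_of_nonneg_left h1 (Real.exp_pos _).le
  have h4 : Real.exp (α σ) * (θ * K) ≤ Real.exp (α t) * (θ * K) :=
    mul_le_mul_of_nonneg_right hmono hxσ
  linarith

theorem exists_zero_or_pos {x : ℝ → ℝ} {u t : ℝ} (hx : ContinuousOn x (Icc u t))
    (hxt : 0 < x t) :
    (∀ s ∈ Icc u t, 0 < x s) ∨ ∃ ξ ∈ Icc u t, x ξ = 0 ∧ ∀ s, ξ < s → s ≤ t → 0 < x s := by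
  by_cases hall : ∀ s ∈ Icc u t, 0 < x s
  · exact Or.inl hall
  right
  push Not at hall
  obtain ⟨s, hs, hxs⟩ := hall
  have hcl : IsCompact (Icc u t ∩ x ⁻¹' Iic 0) :=
    isCompact_Icc.of_isClosed_subset (hx.preimage_isClosed_of_isClosed isClosed_Icc isClosed_Iic)
      inter_subset_left
  obtain ⟨ξ, ⟨hξ, hxξ⟩, hub⟩ := hcl.exists_isGreatest ⟨s, hs, hxs⟩
  have hafter : ∀ s, ξ < s → s ≤ t → 0 < x s := fun s h1 h2 => by
    by_contra! h3
    exact (hub ⟨⟨hξ.1.trans h1.le, h2⟩, h3⟩).not_gt h1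
  refine ⟨ξ, hξ, ?_, hafter⟩
  obtain ⟨r, hr, hxr⟩ : (0 : ℝ) ∈ x '' Icc ξ t :=
    intermediate_value_Icc hξ.2 (hx.mono (Icc_subset_Icc_left hξ.1)) ⟨hxξ, hxt.le⟩
  rcases hr.1.eq_or_lt with h1 | h1
  · rw [h1, hxr]
  · exact absurd hxr (hafter r h1 hr.2).ne'

/-- Either x > 0 since T + h₀, and then it decays at rate at least a₀ from T + 2h₀ on, or
`le_of_zero` applies at its last zero. -/
theorem eventually_le (p : IsDelayedFeedback a₀ A B h₀ T h a α D x)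
    {K H s₀ θ : ℝ} (hB : 0 ≤ B) (hA : 0 ≤ A) (ha₀ : 0 < a₀) (hh₀ : 0 ≤ h₀)
    (hc : IsContractionBound B H s₀ θ) (hH : A * h₀ ≤ H)
    (hK : 0 ≤ K) (hbd : ∀ t, T - h₀ ≤ t → |x t| ≤ K) : ∀ᶠ t in atTop, x t ≤ θ * K := by
  have hlim : Tendsto (fun t => Real.exp (-(a₀ * (t - (T + h₀ + h₀))))) atTop (𝓝 0) := by
    refine Real.tendsto_exp_neg_atTop_nhds_zero.comp ?_
    exact (tendsto_atTop_add_const_right _ _ tendsto_id).const_mul_atTop ha₀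
  filter_upwards [eventually_ge_atTop (T + h₀ + h₀), hlim.eventually_le_const hc.pos] with t ht hθ
  rcases le_or_gt (x t) 0 with hx | hx
  · exact hx.trans (mul_nonneg hc.pos.le hK)
  have hcont : ContinuousOn x (Icc (T + h₀) t) := by
    have := (p.absCont (T + h₀) t (by linarith) (by linarith)).continuousOn
    rwa [uIcc_of_le (by linarith)] at this
  rcases exists_zero_or_pos hcont hx with hpos | ⟨ξ, hξ, hxξ, hpos⟩
  · have h1 := p.exp_mul_sub_le (P := 0) (c := 0) (u := T + h₀ + h₀) (by linarith) ht (fun r hr => by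
      have hTr : T ≤ r := by linarith [hr.1]
      have := p.feedback_upper r hTr 0 le_rfl (fun k => by
        linarith [hpos (h k r) ⟨by linarith [p.le_delay k r hTr, hr.1],
          (p.delay_le k r hTr).trans hr.2⟩])
      linarith)
    have h2 := p.primitive_lower _ _ ht
    have h3 : x (T + h₀ + h₀) ≤ K := (le_abs_self _).trans (hbd _ (by linarith))
    have h4 : Real.exp (α (T + h₀ + h₀)) ≤ Real.exp (α t) * θ := by
      calc Real.exp (α (T + h₀ + h₀))
          ≤ Real.exp (α t + -(a₀ * (t - (T + h₀ + h₀)))) := Real.exp_le_exp.2 (by linarith)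
        _ = Real.exp (α t) * Real.exp (-(a₀ * (t - (T + h₀ + h₀)))) := Real.exp_add _ _
        _ ≤ _ := mul_le_mul_of_nonneg_left hθ (Real.exp_pos _).le
    rw [← mul_le_mul_iff_right₀ (Real.exp_pos (α t))]
    have h5 := mul_le_mul_of_nonneg_left h3 (Real.exp_pos (α (T + h₀ + h₀))).le
    have h6 := mul_le_mul_of_nonneg_right h4 hK
    linarith
  · exact p.le_of_zero hB hA ha₀ hc hH hK hbd (by linarith [hξ.1]) hξ.1 hξ.2 hxξ hpos

theorem tendsto_zero (p : IsDelayedFeedback a₀ A B h₀ T h a α D x)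
    {K H s₀ θ : ℝ} (hB : 0 ≤ B) (hA : 0 ≤ A) (ha₀ : 0 < a₀) (hh₀ : 0 ≤ h₀)
    (hc : IsContractionBound B H s₀ θ) (hθ : θ < 1) (hH : A * h₀ ≤ H)
    (hbd : ∀ᶠ t in atTop, |x t| ≤ K) : Tendsto x atTop (𝓝 0) := by
  have hK : 0 ≤ K := by
    obtain ⟨t, ht⟩ := hbd.exists
    exact (abs_nonneg _).trans ht
  have hiter : ∀ n : ℕ, ∀ᶠ t in atTop, |x t| ≤ θ ^ n * K := by
    intro n
    induction n with
    | zero => simpa using hbd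
    | succ n ih =>
      obtain ⟨S, hS⟩ := eventually_atTop.1 ih
      have hKn : 0 ≤ θ ^ n * K := mul_nonneg (pow_nonneg hc.pos.le n) hK
      -- The shift by h₀ makes the current bound cover the delayed arguments too.
      have q := p.mono (le_max_left T (S + h₀))
      have hbd' : ∀ t, max T (S + h₀) - h₀ ≤ t → |x t| ≤ θ ^ n * K := fun t ht =>
        hS t (by linarith [le_max_right T (S + h₀)])
      filter_upwards [q.eventually_le hB hA ha₀ hh₀ hc hH hKn hbd',
        q.neg.eventually_le hB hA ha₀ hh₀ hc hH hKn (by simpa using hbd')] with t h1 h2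
      rw [pow_succ', mul_assoc]
      exact abs_le.2 ⟨by linarith, h1⟩
  rw [Metric.tendsto_nhds]
  intro ε hε
  have hlim : Tendsto (fun n : ℕ => θ ^ n * K) atTop (𝓝 (0 * K)) :=
    (tendsto_pow_atTop_nhds_zero_of_lt_one hc.pos.le hθ).mul_const K
  rw [zero_mul] at hlim
  obtain ⟨n, hn⟩ := (hlim.eventually_lt_const hε).exists
  filter_upwards [hiter n] with t ht
  rw [Real.dist_eq, sub_zero]
  exact ht.trans_lt hn

/-! ### Choice of the contraction constants -/

theorem exists_isContractionBound {B H₀ : ℝ} (hB : 0 < B)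
    (hmain : Real.log ((B ^ 2 + B) / (B ^ 2 + 1)) < Real.exp (-H₀) / B) :
    ∃ H s₀ θ, H₀ ≤ H ∧ IsContractionBound B H s₀ θ ∧ θ < 1 := by
  set L := Real.log ((B ^ 2 + B) / (B ^ 2 + 1)) with hL
  have hq : 0 < (B ^ 2 + B) / (B ^ 2 + 1) := by positivity
  have hr : 0 < 1 + 1 / B := by positivity
  obtain ⟨H, hH₀, hHr, hHL⟩ : ∃ H, H₀ ≤ H ∧ Real.log (1 + 1 / B) ≤ H ∧ L < Real.exp (-H) / B := by
    rcases le_total (Real.log (1 + 1 / B)) H₀ with hle | hge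
    · exact ⟨H₀, le_rfl, hle, hmain⟩
    -- Raising H keeps s₀ ≥ 0; the strict inequality then holds for every B > 0, by log q ≤ q - 1.
    · refine ⟨_, hge, le_rfl, ?_⟩
      rw [Real.exp_neg, Real.exp_log hr]
      refine (Real.log_le_sub_one_of_pos hq).trans_lt ?_
      have h1 : (B ^ 2 + B) / (B ^ 2 + 1) - 1 = (B - 1) / (B ^ 2 + 1) := by field_simp; ring
      have h2 : (1 + 1 / B)⁻¹ / B = 1 / (B + 1) := by field_simp
      rw [h1, h2, div_lt_div_iff₀ (by positivity) (by positivity)]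
      nlinarith
  have hpos : 0 < B ^ 2 * (Real.exp (-H) / B - L) := mul_pos (by positivity) (by linarith)
  -- The two feedback bounds cross here: B(e^(H-s₀) - 1) = 1.
  set s₀ := H - Real.log (1 + 1 / B) with hs₀
  have hexps : Real.exp s₀ * (B + 1) = B * Real.exp H := by
    rw [hs₀, Real.exp_sub, Real.exp_log hr]
    field_simp
  have hH1 : Real.exp H * Real.exp (-H) = 1 := by rw [← Real.exp_add]; simp
  have late : ∀ τ, s₀ ≤ τ → τ ≤ H →
      Real.exp (-τ) * (B * (Real.exp s₀ - 1) + B ^ 2 * Real.exp H * (τ - s₀)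
        - B ^ 2 * (Real.exp τ - Real.exp s₀)) ≤ 1 - B ^ 2 * (Real.exp (-H) / B - L) := by
    intro τ h1 h2
    -- By `hexps` the left side is B²e^H(1 + τ - s₀) - B - B²e^τ. The tangent to (1 + B²)e^τ at τ =
    -- s₀ + L has the matching slope B²e^H, leaving the gap B - B²e^H L, positive by `hHL`.
    have hN : B * (Real.exp s₀ - 1) + B ^ 2 * Real.exp H * (τ - s₀)
        - B ^ 2 * (Real.exp τ - Real.exp s₀) ≤
        Real.exp τ * (1 - B ^ 2 * (Real.exp (-H) / B - L)) := by
      have hτ : Real.exp τ = Real.exp s₀ * Real.exp (τ - s₀) := by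
        rw [← Real.exp_add]; congr 1; ring
      have hexpL : Real.exp (τ - s₀ - L) * (B * (B + 1)) = Real.exp (τ - s₀) * (B ^ 2 + 1) := by
        rw [Real.exp_sub, hL, Real.exp_log hq]
        field_simp
      have hkey : (1 + B ^ 2) * Real.exp τ = B ^ 2 * Real.exp H * Real.exp (τ - s₀ - L) := by
        rw [hτ]
        linear_combination -Real.exp s₀ * hexpL + B * Real.exp (τ - s₀ - L) * hexps
      have h3 := mul_le_mul_of_nonneg_left (Real.add_one_le_exp (τ - s₀ - L))
        (show 0 ≤ B ^ 2 * Real.exp H by positivity)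
      have h4 := mul_le_mul_of_nonneg_right (Real.exp_le_exp.2 h2) hpos.le
      have h5 : Real.exp H * (B ^ 2 * (Real.exp (-H) / B - L)) =
          B - B ^ 2 * Real.exp H * L := by
        have : B ^ 2 * (Real.exp (-H) / B - L) = B * Real.exp (-H) - B ^ 2 * L := by
          field_simp
        rw [this]
        linear_combination B * hH1
      linear_combination h3 + h4 + h5 - hkey + B * hexps
    have hττ : Real.exp (-τ) * Real.exp τ = 1 := by rw [← Real.exp_add]; simp
    calc _ ≤ Real.exp (-τ) * (Real.exp τ * (1 - B ^ 2 * (Real.exp (-H) / B - L))) :=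
          mul_le_mul_of_nonneg_left hN (Real.exp_pos _).le
      _ = _ := by rw [← mul_assoc, hττ, one_mul]
  have hs₀H : s₀ ≤ H := by
    have := Real.log_nonneg (show (1 : ℝ) ≤ 1 + 1 / B by simp [hB.le])
    linarith
  -- The 1/2 only keeps θ positive.
  refine ⟨H, s₀, max (1 / 2) (1 - B ^ 2 * (Real.exp (-H) / B - L)), hH₀,
    ⟨lt_max_of_lt_left (by norm_num), by linarith, hs₀H, fun τ hτ => ?_,
      fun τ h1 h2 => (late τ h1 h2).trans (le_max_right _ _)⟩,
    max_lt (by norm_num) (by linarith)⟩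
  -- The early bound increases with τ and meets the late one at s₀.
  refine le_trans ?_ ((late s₀ le_rfl hs₀H).trans (le_max_right _ _))
  have h1 : Real.exp (-s₀) * Real.exp s₀ = 1 := by rw [← Real.exp_add]; simp
  have h2 : Real.exp (-s₀) ≤ Real.exp (-τ) := Real.exp_le_exp.2 (by linarith)
  have h3 := mul_le_mul_of_nonneg_left h2 hB.le
  linear_combination h3 - B * h1

end IsDelayedFeedback

/-! ### Reduction to the delayed feedback equation -/

/-- A measurable rate with values in `[a₀, A]` has a Lipschitz primitive with matching slopes. -/
theorem exists_primitive_of_measurable_bounded {a : ℝ → ℝ} {a₀ A : ℝ} (ha : Measurable a)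
    (ha₀ : 0 ≤ a₀) (hl : ∀ s, a₀ ≤ a s) (hu : ∀ s, a s ≤ A) :
    ∃ α : ℝ → ℝ, LipschitzWith A.toNNReal α ∧
      (∀ u v, u ≤ v → a₀ * (v - u) ≤ α v - α u) ∧
      (∀ u v, u ≤ v → α v - α u ≤ A * (v - u)) ∧ ∀ᵐ s, HasDerivAt α (a s) s := by
  have hA : 0 ≤ A := ha₀.trans ((hl 0).trans (hu 0))
  have hloc : LocallyIntegrable a volume := by
    refine (locallyIntegrable_const A).mono ha.aestronglyMeasurable (ae_of_all _ fun s => ?_)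
    rw [Real.norm_of_nonneg (ha₀.trans (hl s)), Real.norm_of_nonneg hA]
    exact hu s
  have hint : ∀ u v, IntervalIntegrable a volume u v := fun u v =>
    (hloc.integrableOn_isCompact isCompact_uIcc).intervalIntegrable
  have hsub : ∀ u v, (∫ s in (0 : ℝ)..v, a s) - ∫ s in (0 : ℝ)..u, a s = ∫ s in u..v, a s :=
    fun u v => intervalIntegral.integral_interval_sub_left (hint 0 v) (hint 0 u)
  refine ⟨fun t => ∫ s in (0 : ℝ)..t, a s, ?_, fun u v huv => ?_, fun u v huv => ?_, ?_⟩
  · refine LipschitzWith.of_dist_le_mul fun u v => ?_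
    rw [dist_comm, dist_comm u, Real.dist_eq, hsub, Real.coe_toNNReal _ hA, Real.dist_eq,
      ← Real.norm_eq_abs]
    exact intervalIntegral.norm_integral_le_of_norm_le_const fun s _ => by
      rw [Real.norm_of_nonneg (ha₀.trans (hl s))]
      exact hu s
  · simp only [hsub]
    have := intervalIntegral.integral_mono_on huv (intervalIntegrable_const (c := a₀)) (hint u v)
      fun s _ => hl s
    simpa [mul_comm] using this
  · simp only [hsub]
    have := intervalIntegral.integral_mono_on huv (hint u v) (intervalIntegrable_const (c := A))
      fun s _ => hu s
    simpa [mul_comm] using this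
  · filter_upwards [LocallyIntegrable.ae_hasDerivAt_integral hloc] with s hs using hs 0

theorem theorem5 {m : ℕ} (hm : 1 ≤ m)
    (f : ℝ → ℝ → ℝ) (g : Fin m → ℝ → ℝ → ℝ) (h : Fin m → ℝ → ℝ)
    -- the delays
    (hh : ∀ k, IsDelayFunction (h k))
    -- continuity and sign conditions on `[0, ∞) × ℝ`
    (hf_cont : ContinuousOn (Function.uncurry f) (Ici (0 : ℝ) ×ˢ univ))
    (hg_cont : ∀ k, ContinuousOn (Function.uncurry (g k)) (Ici (0 : ℝ) ×ˢ univ))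
    (hf_zero : ∀ t, 0 ≤ t → f t 0 = 0)
    (hg_zero : ∀ k t, 0 ≤ t → g k t 0 = 0)
    (hf_sign : ∀ t u, 0 ≤ t → u ≠ 0 → 0 < f t u * u)
    (hg_sign : ∀ k t u, 0 ≤ t → u ≠ 0 → 0 < g k t u * u)
    -- a priori bounds: every admissible initial function has a unique global solution,
    -- which eventually takes its values in `[x₁, x₂]`
    (x₁₀ x₂₀ : EReal) (x₁ x₂ : ℝ)
    (hx₁₀ : x₁₀ ≤ 0) (hx₂₀ : 0 ≤ x₂₀) (hx₁ : x₁ ≤ 0) (hx₂ : 0 ≤ x₂)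
    (h_exists_unique : ∀ φ : Iic (0 : ℝ) → ℝ, IsAdmissibleInitial x₁₀ x₂₀ φ →
      ∃! x : ℝ → ℝ, IsDelaySolution f g h φ x)
    (h_bounds : ∀ φ : Iic (0 : ℝ) → ℝ, IsAdmissibleInitial x₁₀ x₂₀ φ →
      ∀ x : ℝ → ℝ, IsDelaySolution f g h φ x → ∀ᶠ t in atTop, x₁ ≤ x t ∧ x t ≤ x₂)
    -- the quantitative conditions
    (a₀ A h₀ : ℝ) (b : Fin m → ℝ) (b₀ : ℝ)
    (ha₀ : 0 < a₀) (hA : 0 < A) (hb : ∀ k, 0 < b k) (hb₀ : b₀ = ∑ k, b k)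
    (hf_bound : ∀ t u, 0 ≤ t → x₁ ≤ u → u ≤ x₂ → u ≠ 0 → a₀ ≤ f t u / u ∧ f t u / u ≤ A)
    (hg_bound : ∀ k t u, 0 ≤ t → x₁ ≤ u → u ≤ x₂ → u ≠ 0 →
      0 ≤ g k t u / u ∧ g k t u / u ≤ b k)
    (h_delay : ∀ k t, 0 ≤ t → t - h k t ≤ h₀)
    (h_main : a₀ / b₀ * Real.exp (-(A * h₀)) >
      Real.log ((b₀ ^ 2 + a₀ * b₀) / (b₀ ^ 2 + a₀ ^ 2))) :
    ∀ φ : Iic (0 : ℝ) → ℝ, IsAdmissibleInitial x₁₀ x₂₀ φ →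
      ∀ x : ℝ → ℝ, IsDelaySolution f g h φ x → Tendsto x atTop (𝓝 0) := by
  intro φ hφ x hx
  have hev := h_bounds φ hφ x hx
  have hb₀pos : 0 < b₀ := by
    rw [hb₀]
    exact Finset.sum_pos (fun k _ => hb k) ⟨⟨0, hm⟩, Finset.mem_univ _⟩
  have hh₀ : 0 ≤ h₀ := by
    have h1 := h_delay ⟨0, hm⟩ 0 le_rfl
    have h2 := (hh ⟨0, hm⟩).le_self 0 le_rfl
    linarith
  by_cases htriv : x₁ = 0 ∧ x₂ = 0
  -- Here the bounds on f are vacuous and a₀ ≤ A could fail, but x is eventually zero.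
  · refine tendsto_const_nhds.congr' ?_
    filter_upwards [hev] with t ht
    exact le_antisymm (htriv.1 ▸ ht.1) (htriv.2 ▸ ht.2)
  have haA : a₀ ≤ A := by
    obtain ⟨u, h1, h2, h3⟩ : ∃ u, x₁ ≤ u ∧ u ≤ x₂ ∧ u ≠ 0 := by
      by_cases hx₁0 : x₁ = 0
      · exact ⟨x₂, hx₁.trans hx₂, le_rfl, fun h2 => htriv ⟨hx₁0, h2⟩⟩
      · exact ⟨x₁, le_rfl, hx₁.trans hx₂, hx₁0⟩
    exact (hf_bound 0 u le_rfl h1 h2 h3).1.trans (hf_bound 0 u le_rfl h1 h2 h3).2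
  obtain ⟨S, hS⟩ := eventually_atTop.1 hev
  set T₀ := max S 0
  have hT₀nn : 0 ≤ T₀ := le_max_right _ _
  have hrange : ∀ t, T₀ ≤ t → x₁ ≤ x t ∧ x t ≤ x₂ := fun t ht => hS t ((le_max_left _ _).trans ht)
  have hxcont : Continuous fun s : ℝ => x (max s 0) := by
    have hxon : ContinuousOn x (Ici 0) := by
      intro t ht
      have h1 := (hx.absCont (t + 1) (by linarith [mem_Ici.1 ht])).continuousOn
      rw [uIcc_of_le (by linarith [mem_Ici.1 ht])] at h1
      exact (h1 t ⟨ht, by linarith⟩).mono_of_mem_nhdsWithin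
        (mem_nhdsWithin.2 ⟨Iio (t + 1), isOpen_Iio, by simp, fun s hs => ⟨hs.2, hs.1.le⟩⟩)
    exact hxon.comp_continuous (continuous_id.max continuous_const) fun s => mem_Ici.2 (le_max_right _ _)
  have hfcont : Continuous fun s : ℝ => f (max s 0) (x (max s 0)) :=
    hf_cont.comp_continuous ((continuous_id.max continuous_const).prodMk hxcont)
      fun s => ⟨mem_Ici.2 (le_max_right _ _), mem_univ _⟩
  -- Clamping gives a rate in [a₀, A] everywhere; a x = f survives from T₀ on, also at zeros of x
  -- since f(t,0) = 0.
  let a : ℝ → ℝ := fun s => min A (max a₀ (f (max s 0) (x (max s 0)) / x (max s 0)))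
  have ha : Measurable a :=
    measurable_const.min (measurable_const.max (hfcont.measurable.div hxcont.measurable))
  have hal : ∀ s, a₀ ≤ a s := fun s => le_min haA (le_max_left _ _)
  obtain ⟨α, hαlip, hαl, hαu, hαd⟩ := exists_primitive_of_measurable_bounded ha ha₀.le hal
    fun s => min_le_left _ _
  have hax : ∀ s, T₀ ≤ s → a s * x s = f s (x s) := by
    intro s hs
    have hs0 : max s 0 = s := max_eq_left (hT₀nn.trans hs)
    simp only [a, hs0]
    by_cases hx0 : x s = 0
    · rw [hx0, hf_zero s (hT₀nn.trans hs), mul_zero]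
    · have := hf_bound s (x s) (hT₀nn.trans hs) (hrange s hs).1 (hrange s hs).2 hx0
      rw [max_eq_right this.1, min_eq_right this.2, div_mul_cancel₀ _ hx0]
  have hgu : ∀ k t u c, 0 ≤ t → x₁ ≤ u → u ≤ x₂ → 0 ≤ c → u ≤ c → g k t u ≤ b k * c := by
    intro k t u c ht h1 h2 hc huc
    have hbc := mul_nonneg (hb k).le hc
    rcases lt_trichotomy u 0 with hu | hu | hu
    · nlinarith [hg_sign k t u ht hu.ne]
    · rw [hu, hg_zero k t ht]; exact hbc
    · have := (hg_bound k t u ht h1 h2 hu.ne').2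
      rw [div_le_iff₀ hu] at this
      exact this.trans (mul_le_mul_of_nonneg_left huc (hb k).le)
  have hgl : ∀ k t u c, 0 ≤ t → x₁ ≤ u → u ≤ x₂ → 0 ≤ c → -u ≤ c → -g k t u ≤ b k * c := by
    intro k t u c ht h1 h2 hc huc
    have hbc := mul_nonneg (hb k).le hc
    rcases lt_trichotomy u 0 with hu | hu | hu
    · have := (hg_bound k t u ht h1 h2 hu.ne).2
      rw [div_le_iff_of_neg hu] at this
      nlinarith [mul_le_mul_of_nonneg_left huc (hb k).le]
    · rw [hu, hg_zero k t ht]; simpa using hbc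
    · nlinarith [hg_sign k t u ht hu.ne']
  have hfeed : ∀ s c, 0 ≤ c → b₀ * c ≤ b₀ / a₀ * c * a s := by
    intro s c hc
    calc b₀ * c = b₀ / a₀ * c * a₀ := by field_simp
      _ ≤ _ := mul_le_mul_of_nonneg_left (hal s) (by positivity)
  have hT : ∀ s, T₀ + h₀ ≤ s → 0 ≤ s ∧ ∀ k, x₁ ≤ x (h k s) ∧ x (h k s) ≤ x₂ := fun s hs =>
    have hs0 : 0 ≤ s := by linarith
    ⟨hs0, fun k => hrange _ (by linarith [h_delay k s hs0])⟩
  have p : IsDelayedFeedback a₀ A (b₀ / a₀) h₀ (T₀ + h₀) h a α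
      (fun s => -∑ k, g k s (x (h k s))) x :=
    { absCont := fun u v hu huv => (hx.absCont v (by linarith)).mono (by
        rw [uIcc_of_le huv, uIcc_of_le (by linarith)]
        exact Icc_subset_Icc_left (by linarith))
      lipschitz := hαlip
      primitive_lower := hαl
      primitive_upper := hαu
      hasDerivAt := by
        filter_upwards [hαd, (ae_restrict_iff' measurableSet_Ici).1 hx.equation] with s h1 h2 hs
        obtain ⟨h3, h4⟩ := h2 (hT s hs).1
        refine ⟨h1, h3.hasDerivAt.congr_deriv ?_⟩
        rw [hax s (by linarith)]
        linarith
      delay_le := fun k s hs => (hh k).le_self s (hT s hs).1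
      le_delay := fun k s hs => by linarith [h_delay k s (hT s hs).1]
      feedback_upper := fun s hs c hc hxc => by
        refine le_trans ?_ (hfeed s c hc)
        rw [hb₀, Finset.sum_mul, ← Finset.sum_neg_distrib]
        exact Finset.sum_le_sum fun k _ => hgl k s _ c (hT s hs).1 ((hT s hs).2 k).1
          ((hT s hs).2 k).2 hc (hxc k)
      feedback_lower := fun s hs c hc hxc => by
        refine le_trans ?_ (hfeed s c hc)
        rw [neg_neg, hb₀, Finset.sum_mul]
        exact Finset.sum_le_sum fun k _ => hgu k s _ c (hT s hs).1 ((hT s hs).2 k).1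
          ((hT s hs).2 k).2 hc (hxc k) }
  have hB : 0 < b₀ / a₀ := by positivity
  obtain ⟨H, s₀, θ, hH, hc, hθ⟩ :=
    IsDelayedFeedback.exists_isContractionBound (H₀ := A * h₀) hB (by
      have h1 : ((b₀ / a₀) ^ 2 + b₀ / a₀) / ((b₀ / a₀) ^ 2 + 1) =
          (b₀ ^ 2 + a₀ * b₀) / (b₀ ^ 2 + a₀ ^ 2) := by field_simp
      have h2 : Real.exp (-(A * h₀)) / (b₀ / a₀) = a₀ / b₀ * Real.exp (-(A * h₀)) := by
        field_simp
      rw [h1, h2]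
      exact h_main)
  refine p.tendsto_zero hB.le hA.le ha₀ hh₀ hc hθ hH (K := x₂ - x₁) ?_
  filter_upwards [hev] with t ht
  exact abs_le.2 ⟨by linarith, by linarith⟩
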